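/- All algebras are associative and unital over $\mathbb{C}$. For $n\ge 1$ and $q\in\mathbb{C}^\times$, let $TL_n(q)$ be the Temperley--Lieb algebra, with generators $f_1,\dots,f_{n-1}$ and relations $f_i^2=-(q+q^{-1})f_i$, $f_if_{i\pm1}f_i=f_i$, and $f_if_j=f_jf_i$ if $|i-j|\ge 2$. Let $\ell=4$ and $q=-\exp(\pi i/4)$, so that $q^2=i$ has order $\ell$. Let $E_3\in TL_3(q)$ be the Jones--Wenzl idempotent, i.e. the unique nonzero idempotent with $f_jE_3=E_3f_j=0$ for $j=1,2$. For $n\ge 3$ let $Q_n=Q_n(4)=TL_n(q)/\langle E_3\rangle$ (the Ising algebra) be the quotient by the two-sided ideal generated by the image of $E_3$ under the homomorphism $TL_3(q)\to TL_n(q)$, $f_j\mapsto f_j$. Let $U$ be a complex vector space of finite dimension $n$ with a non-degenerate symmetric bilinear form $\langle-,-\rangle$, let $\mathcal{C}_n$ be its Clifford algebra, i.e. the quotient of the tensor algebra of $U$ by the relations $u\otimes u=\langle u,u\rangle 1$ $(u\in U)$, and let $\mathcal{C}_n^0$ be its even subalgebra. **Theorem.** Let $n\ge 3$. The space $U$ has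 an orthonormal basis. For every orthonormal basis $u_1,\dots,u_n$ of $U$, put $\gamma_j=\frac{1}{\sqrt2}u_j$. Then there is an algebra homomorphism $\phi_n:TL_n(q)\to\mathcal{C}_n^0$ with $$\phi_n(f_j)=\tfrac{1}{\sqrt2}\,(1+2i\,\gamma_j\gamma_{j+1})\qquad(1\le j\le n-1).$$ It is surjective, and it induces an algebra isomorphism $\overline{\phi}_n:Q_n\to\mathcal{C}_n^0$, i.e. $\overline{\phi}_n(x+\langle E_3\rangle)=\phi_n(x)$ for all $x\in TL_n(q)$. -/

import Mathlib

/-- The defining relations of the Temperley-Lieb algebra on `n` strings with parameter `q`.  The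
generators are indexed from `0`: the index `j : Fin (n - 1)` stands for the generator usually
written with the index `j + 1`. -/
inductive TemperleyLieb.Rel (n : ℕ) (q : ℂ) :
    FreeAlgebra ℂ (Fin (n - 1)) → FreeAlgebra ℂ (Fin (n - 1)) → Prop
  | sq (i : Fin (n - 1)) :
      TemperleyLieb.Rel n q (FreeAlgebra.ι ℂ i * FreeAlgebra.ι ℂ i)
        ((-(q + q⁻¹)) • FreeAlgebra.ι ℂ i)
  | adjacent (i j : Fin (n - 1)) (h : (i : ℕ) + 1 = j ∨ (j : ℕ) + 1 = i) :
      TemperleyLieb.Rel n q (FreeAlgebra.ι ℂ i * FreeAlgebra.ι ℂ j * FreeAlgebra.ι ℂ i)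
        (FreeAlgebra.ι ℂ i)
  | distant (i j : Fin (n - 1)) (h : (i : ℕ) + 2 ≤ j ∨ (j : ℕ) + 2 ≤ i) :
      TemperleyLieb.Rel n q (FreeAlgebra.ι ℂ i * FreeAlgebra.ι ℂ j)
        (FreeAlgebra.ι ℂ j * FreeAlgebra.ι ℂ i)

/-- The Temperley-Lieb algebra `TL_n(q)` over `ℂ`, by generators and relations. -/
abbrev TemperleyLieb (n : ℕ) (q : ℂ) : Type := RingQuot (TemperleyLieb.Rel n q)

/-- The generators of `TL_n(q)`. -/
noncomputable def TemperleyLieb.gen (n : ℕ) (q : ℂ) (j : Fin (n - 1)) : TemperleyLieb n q :=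
  RingQuot.mkAlgHom ℂ (TemperleyLieb.Rel n q) (FreeAlgebra.ι ℂ j)

/-- The canonical homomorphism `TL_m(q) → TL_n(q)` for `m ≤ n`, sending each generator to the
generator with the same index. -/
noncomputable def TemperleyLieb.incl (q : ℂ) {m n : ℕ} (h : m ≤ n) :
    TemperleyLieb m q →ₐ[ℂ] TemperleyLieb n q :=
  RingQuot.liftAlgHom ℂ
    ⟨FreeAlgebra.lift ℂ fun j : Fin (m - 1) =>
        TemperleyLieb.gen n q (Fin.castLE (Nat.sub_le_sub_right h 1) j), by
      intro x y hxy
      cases hxy with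
      | sq i =>
        simpa [TemperleyLieb.gen] using RingQuot.mkAlgHom_rel ℂ
          (TemperleyLieb.Rel.sq (q := q) (Fin.castLE (Nat.sub_le_sub_right h 1) i))
      | adjacent i j hij =>
        simpa [TemperleyLieb.gen] using RingQuot.mkAlgHom_rel ℂ
          (TemperleyLieb.Rel.adjacent (q := q) (Fin.castLE (Nat.sub_le_sub_right h 1) i)
            (Fin.castLE (Nat.sub_le_sub_right h 1) j) (by simpa using hij))
      | distant i j hij =>
        simpa [TemperleyLieb.gen] using RingQuot.mkAlgHom_rel ℂ
          (TemperleyLieb.Rel.distant (q := q) (Fin.castLE (Nat.sub_le_sub_right h 1) i)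
            (Fin.castLE (Nat.sub_le_sub_right h 1) j) (by simpa using hij))⟩

/-- `E` is the Jones-Wenzl idempotent of `TL_m(q)`: the nonzero idempotent which is annihilated
on both sides by all generators. There is at most one such element
(`TemperleyLieb.IsJonesWenzl.eq`). -/
structure TemperleyLieb.IsJonesWenzl {m : ℕ} {q : ℂ} (E : TemperleyLieb m q) : Prop where
  ne_zero : E ≠ 0
  idem : E * E = E
  gen_mul : ∀ j : Fin (m - 1), TemperleyLieb.gen m q j * E = 0
  mul_gen : ∀ j : Fin (m - 1), E * TemperleyLieb.gen m q j = 0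

/-- If `E` is annihilated on both sides by all generators, then every `x` acts on `E` by a scalar,
from both sides. -/
theorem TemperleyLieb.IsJonesWenzl.exists_scalar {m : ℕ} {q : ℂ} (x : TemperleyLieb m q) :
    ∃ c : ℂ, ∀ E : TemperleyLieb m q, TemperleyLieb.IsJonesWenzl E →
      x * E = c • E ∧ E * x = c • E := by
  obtain ⟨a, rfl⟩ := RingQuot.mkAlgHom_surjective ℂ (TemperleyLieb.Rel m q) x
  induction a using FreeAlgebra.induction with
  | grade0 r => exact ⟨r, fun E _ => by simp [Algebra.smul_def, Algebra.commutes]⟩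
  | grade1 j => exact ⟨0, fun E hE => by
      simpa [TemperleyLieb.gen] using And.intro (hE.gen_mul j) (hE.mul_gen j)⟩
  | mul a b ha hb =>
    obtain ⟨c, hc⟩ := ha
    obtain ⟨d, hd⟩ := hb
    refine ⟨c * d, fun E hE => ⟨?_, ?_⟩⟩
    · rw [map_mul, mul_assoc, (hd E hE).1, mul_smul_comm, (hc E hE).1, smul_smul, mul_comm]
    · rw [map_mul, ← mul_assoc, (hc E hE).2, smul_mul_assoc, (hd E hE).2, smul_smul]
  | add a b ha hb =>
    obtain ⟨c, hc⟩ := ha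
    obtain ⟨d, hd⟩ := hb
    refine ⟨c + d, fun E hE => ⟨?_, ?_⟩⟩
    · rw [map_add, add_mul, (hc E hE).1, (hd E hE).1, add_smul]
    · rw [map_add, mul_add, (hc E hE).2, (hd E hE).2, add_smul]

/-- Uniqueness of the Jones-Wenzl idempotent. -/
theorem TemperleyLieb.IsJonesWenzl.eq {m : ℕ} {q : ℂ} {E E' : TemperleyLieb m q}
    (hE : TemperleyLieb.IsJonesWenzl E) (hE' : TemperleyLieb.IsJonesWenzl E') : E = E' := by
  have key : ∀ F : TemperleyLieb m q, TemperleyLieb.IsJonesWenzl F →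
      ∀ G, TemperleyLieb.IsJonesWenzl G → F * G = G ∧ G * F = G := by
    intro F hF G hG
    obtain ⟨c, hc⟩ := TemperleyLieb.IsJonesWenzl.exists_scalar F
    have h1 : c • F = (1 : ℂ) • F := by rw [← (hc F hF).1, hF.idem, one_smul]
    have h2 : c = 1 := smul_left_injective ℂ hF.ne_zero h1
    simpa [h2] using hc G hG
  rw [← (key E' hE' E hE).1, (key E hE E' hE').2]

/-- The two-sided ideal `R_n(q)` of `TL_n(q)` generated by the image of the Jones-Wenzl idempotent
`E_{ℓ-1}` of `TL_{ℓ-1}(q)`, where `ℓ` is the order of `q ^ 2`. For `n < ℓ - 1` it is zero. -/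
noncomputable def TemperleyLieb.jonesIdeal (ℓ n : ℕ) (q : ℂ) :
    TwoSidedIdeal (TemperleyLieb n q) :=
  TwoSidedIdeal.span {x | ∃ (h : ℓ - 1 ≤ n) (E : TemperleyLieb (ℓ - 1) q),
    TemperleyLieb.IsJonesWenzl E ∧ x = TemperleyLieb.incl q h E}

/-- The Jones algebra `Q_n(ℓ) = TL_n(q) / R_n(q)`, where `ℓ` is the order of `q ^ 2`; the Ising
algebra when `ℓ = 4`. -/
abbrev JonesAlgebra (ℓ n : ℕ) (q : ℂ) : Type :=
  (TemperleyLieb.jonesIdeal ℓ n q).ringCon.Quotient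

/-- The quotient map `TL_n(q) → Q_n(ℓ)`. -/
noncomputable def JonesAlgebra.mk (ℓ n : ℕ) (q : ℂ) : TemperleyLieb n q →ₐ[ℂ] JonesAlgebra ℓ n q :=
  RingCon.mkₐ ℂ (TemperleyLieb.jonesIdeal ℓ n q).ringCon

/-- The value `q = -exp(πi/4)`, for which `q ^ 2 = i` has order `4`. -/
noncomputable def isingParameter : ℂ := -Complex.exp (Real.pi * Complex.I / 4)

/-- A basis `u` of `U` is orthonormal for the bilinear form `B`. -/
def IsOrthonormalBasis {n : ℕ} {U : Type*} [AddCommGroup U] [Module ℂ U]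
    (B : LinearMap.BilinForm ℂ U) (u : Module.Basis (Fin n) ℂ U) : Prop :=
  ∀ i j, B (u i) (u j) = if i = j then 1 else 0

/-- The Clifford algebra of `(U, B)`: the tensor algebra of `U` modulo the relations
`u ⊗ u = B u u`. -/
abbrev cliffordOf {U : Type*} [AddCommGroup U] [Module ℂ U] (B : LinearMap.BilinForm ℂ U) :
    Type _ :=
  CliffordAlgebra B.toQuadraticMap

/-- The even subalgebra of the Clifford algebra of `(U, B)`. -/
abbrev evenCliffordOf {U : Type*} [AddCommGroup U] [Module ℂ U] (B : LinearMap.BilinForm ℂ U) :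
    Subalgebra ℂ (cliffordOf B) :=
  CliffordAlgebra.even B.toQuadraticMap

/-- The elements `γ_i = u_i / √2` of the Clifford algebra. -/
noncomputable def cliffordGamma {n : ℕ} {U : Type*} [AddCommGroup U] [Module ℂ U]
    (B : LinearMap.BilinForm ℂ U) (u : Module.Basis (Fin n) ℂ U) (i : Fin n) : cliffordOf B :=
  CliffordAlgebra.ι B.toQuadraticMap ((1 / (Real.sqrt 2 : ℂ)) • u i)

/-! ### Orthonormal bases of complex quadratic spaces -/

/-! At this `q` the loop value is `-(q + q⁻¹) = √2`, and the substitution `e = √2 f - 1` turns the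
square relation into `e² = 1`. The anticommutator of two such elements is twice the explicit
Jones-Wenzl element in the two generators (`anticommutator_eq_jonesWenzlElement`). In the quotient,
consecutive `e`'s therefore anticommute and distant ones commute, exactly like the elements `i u_j
u_{j+1}` of the even Clifford algebra. The ideal kills only the first Jones-Wenzl element;
invertible braid elements conjugate it to all the others (`jonesWenzlElement_eq_zero_of_adjacent`).

The isomorphism needs no dimension count, because an inverse is constructed. Put `b_k = -i e_k`, the
counterpart of `u_k u_{k+1}`. The product `c_k = b_0 ⋯ b_{k-1}` then stands for `u_0 u_k` and its
inverse for `u_k u_0`. The universal property of the even Clifford algebra yields a homomorphism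
`u_i u_j ↦ c_i⁻¹ c_j`, provided both `c_i⁻¹ c_j` and `c_i c_j⁻¹` are antisymmetric for `i ≠ j`. Both
composites are the identity on generators. -/

theorem exists_isOrthonormalBasis {n : ℕ} {U : Type*} [AddCommGroup U] [Module ℂ U]
    [FiniteDimensional ℂ U] (hU : Module.finrank ℂ U = n) (B : LinearMap.BilinForm ℂ U)
    (hsymm : B.IsSymm) (hnd : B.Nondegenerate) :
    ∃ u : Module.Basis (Fin n) ℂ U, IsOrthonormalBasis B u := by
  subst hU
  have : Invertible (2 : ℂ) := invertibleOfNonzero two_ne_zero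
  obtain ⟨v, hv⟩ := LinearMap.BilinForm.exists_orthogonal_basis (B := B) ⟨hsymm.eq⟩
  -- An isotropic vector of an orthogonal basis would lie in the radical, so each basis vector can
  -- be divided by a square root of its norm.
  have hne := hv.not_isOrtho_basis_self_of_separatingLeft hnd.1
  choose r hr using fun i => IsAlgClosed.exists_pow_nat_eq (B (v i) (v i)) two_pos
  have hr0 : ∀ i, r i ≠ 0 := fun i h => hne i (by rw [← hr, h]; simp)
  refine ⟨v.unitsSMul fun i => (Units.mk0 (r i) (hr0 i))⁻¹, fun i j => ?_⟩
  simp only [Module.Basis.unitsSMul_apply, Units.smul_def, Units.val_inv_eq_inv_val, Units.val_mk0,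
    map_smul, LinearMap.smul_apply, smul_eq_mul]
  split_ifs with h
  · subst h
    rw [← hr]
    field_simp [hr0 i]
  · rw [show B (v i) (v j) = 0 from hv h]
    simp

/-! ### Products of consecutive anticommuting square roots of `-1` -/

section ChainProd

variable {A : Type*} [Ring A]

/-- The product `b 0 * b 1 * ⋯ * b (k - 1)`. -/
def chainProd (b : ℕ → A) : ℕ → A
  | 0 => 1
  | k + 1 => chainProd b k * b k

/-- The product `(-b (k - 1)) * ⋯ * (-b 1) * (-b 0)`, which is the inverse of `chainProd b k` when
every `b i` squares to `-1`. -/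
def chainProdInv (b : ℕ → A) : ℕ → A
  | 0 => 1
  | k + 1 => -(b k * chainProdInv b k)

variable {b : ℕ → A} {m : ℕ}

theorem chainProd_mul_chainProdInv (hsq : ∀ k < m, b k * b k = -1) {k : ℕ} (hk : k ≤ m) :
    chainProd b k * chainProdInv b k = 1 := by
  induction k with
  | zero => simp [chainProd, chainProdInv]
  | succ k ih =>
    rw [chainProd, chainProdInv, mul_neg, mul_assoc, ← mul_assoc (b k), hsq k hk]
    simpa using ih (by omega)

theorem chainProdInv_mul_chainProd (hsq : ∀ k < m, b k * b k = -1) {k : ℕ} (hk : k ≤ m) :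
    chainProdInv b k * chainProd b k = 1 := by
  induction k with
  | zero => simp [chainProd, chainProdInv]
  | succ k ih =>
    rw [chainProd, chainProdInv, neg_mul, mul_assoc, ← mul_assoc (chainProdInv b k),
      ih (by omega), one_mul, hsq k hk, neg_neg]

theorem commute_chainProd (hcomm : ∀ i j, i + 2 ≤ j → j < m → Commute (b i) (b j)) {j k : ℕ}
    (hj : j < k) (hk : k < m) : Commute (chainProd b j) (b k) := by
  induction j with
  | zero => exact Commute.one_left _
  | succ j ih => exact (ih (by omega)).mul_left (hcomm j k (by omega) hk)

theorem commute_chainProdInv (hcomm : ∀ i j, i + 2 ≤ j → j < m → Commute (b i) (b j)) {j k : ℕ}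
    (hj : j < k) (hk : k < m) : Commute (chainProdInv b j) (b k) := by
  induction j with
  | zero => exact Commute.one_left _
  | succ j ih => exact ((hcomm j k (by omega) hk).mul_left (ih (by omega))).neg_left

/-- For `i < j` the left side is the word `b i ⋯ b (j - 1)`. Appending the letter `b j` is the same
as prepending `-b j`, since `b j` anticommutes with the last letter and commutes with the others. -/
theorem chainProdInv_mul_chainProd_antisymm_of_lt (hsq : ∀ k < m, b k * b k = -1)
    (hcomm : ∀ i j, i + 2 ≤ j → j < m → Commute (b i) (b j))
    (hanti : ∀ k, k + 1 < m → b k * b (k + 1) = -(b (k + 1) * b k)) {i j : ℕ} (hij : i < j)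
    (hj : j ≤ m) :
    chainProdInv b i * chainProd b j = -(chainProdInv b j * chainProd b i) := by
  induction j, hij using Nat.le_induction with
  | base =>
    have h := chainProdInv_mul_chainProd hsq (show i ≤ m by omega)
    rw [chainProd, chainProdInv, neg_mul, neg_neg, ← mul_assoc, h, mul_assoc, h, one_mul, mul_one]
  | succ k hik ih =>
    obtain ⟨p, rfl⟩ : ∃ p, k = p + 1 := ⟨k - 1, by omega⟩
    have h1 := (commute_chainProdInv hcomm (show i < p + 1 by omega) (by omega)).mul_left
      (commute_chainProd hcomm (Nat.lt_succ_self p) (by omega))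
    have h2 : chainProdInv b i * chainProd b (p + 1) * b (p + 1) =
        -(b (p + 1) * (chainProdInv b i * chainProd b (p + 1))) := by
      rw [chainProd, ← mul_assoc, mul_assoc _ (b p), hanti p (by omega), mul_neg, ← mul_assoc,
        h1.eq, mul_assoc]
    rw [chainProd, ← mul_assoc, h2, ih (by omega), mul_neg, ← mul_assoc, ← neg_mul]
    rfl

theorem chainProdInv_mul_chainProd_antisymm (hsq : ∀ k < m, b k * b k = -1)
    (hcomm : ∀ i j, i + 2 ≤ j → j < m → Commute (b i) (b j))
    (hanti : ∀ k, k + 1 < m → b k * b (k + 1) = -(b (k + 1) * b k)) {i j : ℕ} (hij : i ≠ j)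
    (hi : i ≤ m) (hj : j ≤ m) :
    chainProdInv b i * chainProd b j = -(chainProdInv b j * chainProd b i) := by
  rcases hij.lt_or_gt with h | h
  · exact chainProdInv_mul_chainProd_antisymm_of_lt hsq hcomm hanti h hj
  · rw [chainProdInv_mul_chainProd_antisymm_of_lt hsq hcomm hanti h hi, neg_neg]

/-- With `c = chainProd b`, the previous antisymmetry gives `c_j c_i⁻¹ c_j = -c_i`; multiply by
`c_j⁻¹` on the right. -/
theorem chainProd_mul_chainProdInv_antisymm (hsq : ∀ k < m, b k * b k = -1)
    (hcomm : ∀ i j, i + 2 ≤ j → j < m → Commute (b i) (b j))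
    (hanti : ∀ k, k + 1 < m → b k * b (k + 1) = -(b (k + 1) * b k)) {i j : ℕ} (hij : i ≠ j)
    (hi : i ≤ m) (hj : j ≤ m) :
    chainProd b i * chainProdInv b j = -(chainProd b j * chainProdInv b i) := by
  have h := chainProdInv_mul_chainProd_antisymm hsq hcomm hanti hij hi hj
  have hi' : chainProd b j * (chainProdInv b i * chainProd b j) = -chainProd b i := by
    rw [h, mul_neg, ← mul_assoc, chainProd_mul_chainProdInv hsq hj, one_mul]
  rw [← neg_eq_iff_eq_neg.mpr hi', neg_mul, mul_assoc, mul_assoc,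
    chainProd_mul_chainProdInv hsq hj, mul_one]

end ChainProd

/-! ### Homomorphisms out of the even Clifford algebra -/

section EvenClifford

variable {n : ℕ} {U : Type*} [AddCommGroup U] [Module ℂ U] {B : LinearMap.BilinForm ℂ U}
  {u : Module.Basis (Fin n) ℂ U} {A : Type*} [Ring A] [Algebra ℂ A]

/-- Polarisation: the symmetrised product is bilinear and agrees with `2 B` on basis pairs, so its
diagonal is twice the claim. -/
theorem IsOrthonormalBasis.constr_mul_constr_self (hu : IsOrthonormalBasis B u) {x y : Fin n → A}
    (hself : ∀ i, y i * x i = 1) (hanti : ∀ i j, i ≠ j → y i * x j = -(y j * x i)) (v : U) :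
    u.constr ℂ y v * u.constr ℂ x v = algebraMap ℂ A (B v v) := by
  set f := (LinearMap.mul ℂ A).compl₁₂ (u.constr ℂ y) (u.constr ℂ x)
  have h : f + f.flip = (2 : ℂ) • B.compr₂ (Algebra.linearMap ℂ A) := by
    refine LinearMap.ext_basis u u fun i j => ?_
    by_cases hij : i = j
    · subst hij
      simp [f, hself, hu i i, two_smul, one_add_one_eq_two]
    · simp [f, hanti i j hij, hu i j, hij]
  have h' := LinearMap.congr_fun₂ h v v
  have h'' : (2 : ℂ) • (u.constr ℂ y v * u.constr ℂ x v) = (2 : ℂ) • algebraMap ℂ A (B v v) := by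
    rw [two_smul]
    exact h'
  exact smul_right_injective A (two_ne_zero' ℂ) h''

/-- The homomorphism from the even Clifford algebra that sends the product `u i * u j` of two
vectors of an orthonormal basis to `y i * x j`. -/
noncomputable def IsOrthonormalBasis.evenLift (hu : IsOrthonormalBasis B u) (x y : Fin n → A)
    (hyx : ∀ i, y i * x i = 1) (hyx' : ∀ i j, i ≠ j → y i * x j = -(y j * x i))
    (hxy : ∀ i, x i * y i = 1) (hxy' : ∀ i j, i ≠ j → x i * y j = -(x j * y i)) :
    evenCliffordOf B →ₐ[ℂ] A :=
  CliffordAlgebra.even.lift B.toQuadraticMap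
    { bilin := (LinearMap.mul ℂ A).compl₁₂ (u.constr ℂ y) (u.constr ℂ x)
      contract := fun v => hu.constr_mul_constr_self hyx hyx' v
      contract_mid := fun v₁ v₂ v₃ => by
        -- The inner factor of `y(v₁) x(v₂) y(v₂) x(v₃)` has the opposite order, which is why
        -- relations for `x i * y j` are required as well.
        have h := hu.constr_mul_constr_self hxy hxy' v₂
        simp only [LinearMap.compl₁₂_apply, LinearMap.mul_apply',
          LinearMap.BilinMap.toQuadraticMap_apply]
        rw [mul_assoc, ← mul_assoc (u.constr ℂ x v₂), h, ← Algebra.smul_def, mul_smul_comm] }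

/-- The product `u i * u j` of two basis vectors in the even Clifford algebra. -/
noncomputable def evenPair (B : LinearMap.BilinForm ℂ U) (u : Module.Basis (Fin n) ℂ U)
    (i j : Fin n) : evenCliffordOf B :=
  (CliffordAlgebra.even.ι B.toQuadraticMap).bilin (u i) (u j)

theorem IsOrthonormalBasis.evenLift_evenPair (hu : IsOrthonormalBasis B u) (x y : Fin n → A)
    (hyx : ∀ i, y i * x i = 1) (hyx' : ∀ i j, i ≠ j → y i * x j = -(y j * x i))
    (hxy : ∀ i, x i * y i = 1) (hxy' : ∀ i j, i ≠ j → x i * y j = -(x j * y i)) (i j : Fin n) :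
    hu.evenLift x y hyx hyx' hxy hxy' (evenPair B u i j) = y i * x j := by
  rw [IsOrthonormalBasis.evenLift, evenPair, CliffordAlgebra.even.lift_ι]
  simp

theorem evenClifford_algHom_ext {f g : evenCliffordOf B →ₐ[ℂ] A}
    (h : ∀ i j, f (evenPair B u i j) = g (evenPair B u i j)) : f = g := by
  apply CliffordAlgebra.even.algHom_ext
  ext1
  exact LinearMap.ext_basis u u h

theorem IsOrthonormalBasis.evenPair_self (hu : IsOrthonormalBasis B u) (i : Fin n) :
    evenPair B u i i = 1 := by
  rw [evenPair, (CliffordAlgebra.even.ι B.toQuadraticMap).contract]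
  simp [hu i i]

theorem IsOrthonormalBasis.evenPair_mul_evenPair (hu : IsOrthonormalBasis B u) (i j k : Fin n) :
    evenPair B u i j * evenPair B u j k = evenPair B u i k := by
  rw [evenPair, evenPair, (CliffordAlgebra.even.ι B.toQuadraticMap).contract_mid]
  simp [hu j j, evenPair]

theorem IsOrthonormalBasis.ι_mul_ι (hu : IsOrthonormalBasis B u) {i j : Fin n} (hij : i ≠ j) :
    CliffordAlgebra.ι B.toQuadraticMap (u i) * CliffordAlgebra.ι B.toQuadraticMap (u j) =
      -(CliffordAlgebra.ι B.toQuadraticMap (u j) * CliffordAlgebra.ι B.toQuadraticMap (u i)) := by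
  apply CliffordAlgebra.ι_mul_ι_comm_of_isOrtho
  simp [QuadraticMap.isOrtho_def, hu i j, hu j i, hij, hij.symm]

theorem IsOrthonormalBasis.evenPair_swap (hu : IsOrthonormalBasis B u) {i j : Fin n}
    (hij : i ≠ j) : evenPair B u i j = -evenPair B u j i :=
  Subtype.ext (hu.ι_mul_ι hij)

theorem IsOrthonormalBasis.evenPair_commute (hu : IsOrthonormalBasis B u) {i j k l : Fin n}
    (hik : i ≠ k) (hil : i ≠ l) (hjk : j ≠ k) (hjl : j ≠ l) :
    Commute (evenPair B u i j) (evenPair B u k l) := by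
  refine Subtype.ext ?_
  change CliffordAlgebra.ι B.toQuadraticMap (u i) * CliffordAlgebra.ι B.toQuadraticMap (u j) *
      (CliffordAlgebra.ι B.toQuadraticMap (u k) * CliffordAlgebra.ι B.toQuadraticMap (u l)) =
    CliffordAlgebra.ι B.toQuadraticMap (u k) * CliffordAlgebra.ι B.toQuadraticMap (u l) *
      (CliffordAlgebra.ι B.toQuadraticMap (u i) * CliffordAlgebra.ι B.toQuadraticMap (u j))
  have hik := hu.ι_mul_ι hik
  have hil := hu.ι_mul_ι hil
  have hjk := hu.ι_mul_ι hjk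
  have hjl := hu.ι_mul_ι hjl
  generalize CliffordAlgebra.ι B.toQuadraticMap (u i) = a at *
  generalize CliffordAlgebra.ι B.toQuadraticMap (u j) = b at *
  generalize CliffordAlgebra.ι B.toQuadraticMap (u k) = c at *
  generalize CliffordAlgebra.ι B.toQuadraticMap (u l) = d at *
  -- Moving one vector past two vectors orthogonal to it produces two signs, which cancel.
  have h1 : a * b * c = c * (a * b) := by
    rw [mul_assoc, hjk, mul_neg, ← mul_assoc, hik, neg_mul, neg_neg, mul_assoc]
  have h2 : a * b * d = d * (a * b) := by
    rw [mul_assoc, hjl, mul_neg, ← mul_assoc, hil, neg_mul, neg_neg, mul_assoc]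
  rw [← mul_assoc, h1, mul_assoc, h2, mul_assoc]

end EvenClifford

/-! ### Temperley-Lieb relations with loop parameter `√2` -/

section LoopSqrtTwo

variable {A : Type*} [Ring A] [Algebra ℂ A] {s : ℂ}

/-- The Jones-Wenzl element on two adjacent Temperley-Lieb generators with loop parameter `s`,
where `s ^ 2 = 2`. -/
def jonesWenzlElement (s : ℂ) (f f' : A) : A := 1 - s • (f + f') + (f * f' + f' * f)

theorem jonesWenzlElement_comm (s : ℂ) (f f' : A) :
    jonesWenzlElement s f f' = jonesWenzlElement s f' f := by
  rw [jonesWenzlElement, jonesWenzlElement, add_comm f f', add_comm (f * f')]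

theorem map_jonesWenzlElement {C : Type*} [Ring C] [Algebra ℂ C] (g : A →ₐ[ℂ] C) (f f' : A) :
    g (jonesWenzlElement s f f') = jonesWenzlElement s (g f) (g f') := by
  simp [jonesWenzlElement]

/-- The terms in `f * f'` cancel, and `f` is left with the coefficient `2 - s²`. -/
theorem mul_jonesWenzlElement (hs : s * s = 2) {f f' : A} (hf : f * f = s • f)
    (hff' : f * f' * f = f) : f * jonesWenzlElement s f f' = 0 := by
  have h : f * jonesWenzlElement s f f' = f - s • (f * f + f * f') + (f * f * f' + f * f' * f) := by
    simp only [jonesWenzlElement, mul_add, mul_sub, mul_one, mul_smul_comm, mul_assoc]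
  rw [h, hff', hf, smul_mul_assoc, smul_add, smul_smul, hs, two_smul]
  abel

theorem jonesWenzlElement_mul (hs : s * s = 2) {f f' : A} (hf : f * f = s • f)
    (hff' : f * f' * f = f) : jonesWenzlElement s f f' * f = 0 := by
  have h : jonesWenzlElement s f f' * f =
      f - s • (f * f + f' * f) + (f * f' * f + f' * (f * f)) := by
    simp only [jonesWenzlElement, add_mul, sub_mul, one_mul, smul_mul_assoc, mul_assoc]
  rw [h, hff', hf, mul_smul_comm, smul_add, smul_smul, hs, two_smul]
  abel

/-- Both generators annihilate the element, so only the constant term `1` of the left factor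
contributes. -/
theorem jonesWenzlElement_mul_self (hs : s * s = 2) {f f' : A} (hf : f * f = s • f)
    (hf' : f' * f' = s • f') (hff' : f * f' * f = f) (hff'' : f' * f * f' = f') :
    jonesWenzlElement s f f' * jonesWenzlElement s f f' = jonesWenzlElement s f f' := by
  have h1 := mul_jonesWenzlElement hs hf hff'
  have h2 := mul_jonesWenzlElement hs hf' hff''
  rw [jonesWenzlElement_comm] at h2
  nth_rw 1 [jonesWenzlElement]
  simp only [add_mul, sub_mul, one_mul, smul_mul_assoc, mul_assoc, h1, h2, mul_zero, add_zero,
    smul_zero, sub_zero]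

/-- Anticommutation of the square roots `s • f - 1` of `1` is the vanishing of the Jones-Wenzl
element. -/
theorem anticommutator_eq_jonesWenzlElement (hs : s * s = 2) (f f' : A) :
    (s • f - 1) * (s • f' - 1) + (s • f' - 1) * (s • f - 1) =
      (2 : ℂ) • jonesWenzlElement s f f' := by
  simp only [jonesWenzlElement, sub_mul, mul_sub, smul_mul_smul_comm, hs, one_mul, mul_one,
    smul_add, smul_sub, smul_smul, mul_comm (2 : ℂ) s, two_smul ℂ (1 : A), mul_two, add_smul]
  abel

theorem smul_sub_one_mul_self (hs : s * s = 2) {f : A} (hf : f * f = s • f) :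
    (s • f - 1) * (s • f - 1) = 1 := by
  simp only [sub_mul, mul_sub, smul_mul_smul_comm, hs, one_mul, mul_one, hf, smul_smul]
  rw [two_mul, add_smul]
  abel

/-- The Temperley-Lieb square relation for `(1 + e) / √2`, where `e ^ 2 = 1`. -/
theorem inv_smul_one_add_mul_self (hs : s * s = 2) {e : A} (he : e * e = 1) :
    (s⁻¹ • (1 + e)) * (s⁻¹ • (1 + e)) = s • (s⁻¹ • (1 + e)) := by
  have hs0 : s ≠ 0 := by rintro rfl; simp at hs
  have h : (1 + e) * (1 + e) = (2 : ℂ) • (1 + e) := by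
    rw [mul_add, mul_one, add_mul, one_mul, he, two_smul]
    abel
  rw [smul_mul_smul_comm, h, smul_smul, smul_smul, ← hs]
  congr 1
  field_simp

/-- The Temperley-Lieb braid-type relation for `(1 + e) / √2`, where `e ^ 2 = 1`. -/
theorem inv_smul_one_add_mul_mul (hs : s * s = 2) {e e' : A} (he : e * e = 1)
    (hee' : e * e' = -(e' * e)) :
    (s⁻¹ • (1 + e)) * (s⁻¹ • (1 + e')) * (s⁻¹ • (1 + e)) = s⁻¹ • (1 + e) := by
  have hs0 : s ≠ 0 := by rintro rfl; simp at hs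
  have h : (1 + e) * (1 + e') * (1 + e) = (2 : ℂ) • (1 + e) := by
    have h' : e * e' * e = -e' := by rw [hee', neg_mul, mul_assoc, he, mul_one]
    simp only [add_mul, mul_add, one_mul, mul_one, he, h', two_smul]
    rw [hee']
    abel
  rw [smul_mul_smul_comm, smul_mul_smul_comm, h, smul_smul, ← hs]
  congr 1
  field_simp

/-- The braid element `(1 + a f) (1 + a f')` conjugates `f` to `f'`. -/
theorem braid_mul {a : ℂ} (ha : a * a + s * a + 1 = 0) {f f' : A} (hf : f * f = s • f)
    (hf' : f' * f' = s • f') (hff' : f * f' * f = f) (hff'' : f' * f * f' = f') :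
    (1 + a • f) * (1 + a • f') * f = f' * ((1 + a • f) * (1 + a • f')) := by
  -- The quadratic equation for `a` kills the coefficient of `f`, and that of `f'` on the other
  -- side; both sides reduce to `a • (f' * f)`.
  have h1 : (1 + a • f) * (1 + a • f') * f = (a * a + s * a + 1) • f + a • (f' * f) := by
    have : (1 + a • f) * (1 + a • f') * f =
        f + a • (f * f) + a • (f' * f) + (a * a) • (f * f' * f) := by
      simp only [add_mul, mul_add, one_mul, mul_one, smul_mul_assoc, mul_smul_comm, smul_add,
        smul_smul, mul_assoc]
      abel
    rw [this, hf, hff', smul_smul, add_smul, add_smul, one_smul, mul_comm a s]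
    abel
  have h2 : f' * ((1 + a • f) * (1 + a • f')) = (a * a + s * a + 1) • f' + a • (f' * f) := by
    have : f' * ((1 + a • f) * (1 + a • f')) =
        f' + a • (f' * f') + a • (f' * f) + (a * a) • (f' * f * f') := by
      simp only [add_mul, mul_add, one_mul, mul_one, smul_mul_assoc, mul_smul_comm, smul_add,
        smul_smul, mul_assoc]
      abel
    rw [this, hf', hff'', smul_smul, add_smul, add_smul, one_smul, mul_comm a s]
    abel
  rw [h1, h2, ha, zero_smul, zero_smul]

/-- The roots of the quadratic are `a` and `a⁻¹`, with sum `-s`; the inverse is `1 + a⁻¹ • f`. -/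
theorem isUnit_one_add_smul {a : ℂ} (ha : a * a + s * a + 1 = 0) {f : A} (hf : f * f = s • f) :
    IsUnit (1 + a • f) := by
  have ha0 : a ≠ 0 := by rintro rfl; simp at ha
  have hc : a + a⁻¹ + s = 0 := by
    field_simp
    linear_combination ha
  have key : ∀ c d : ℂ, c * d = 1 → c + d + s = 0 → (1 + c • f) * (1 + d • f) = 1 := by
    intro c d hcd h
    have : (1 + c • f) * (1 + d • f) = 1 + (c + d + c * d * s) • f := by
      simp only [add_mul, mul_add, one_mul, mul_one, smul_mul_smul_comm, hf, smul_smul, add_smul]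
      abel
    rw [this, hcd, one_mul, h, zero_smul, add_zero]
  exact ⟨⟨_, 1 + a⁻¹ • f, key _ _ (mul_inv_cancel₀ ha0) hc,
    key _ _ (inv_mul_cancel₀ ha0) (by rw [add_comm a⁻¹, hc])⟩, rfl⟩

/-- The vanishing of the Jones-Wenzl element on a pair of adjacent generators propagates to the
next pair. -/
theorem jonesWenzlElement_eq_zero_of_adjacent (hs : s * s = 2) {f₁ f₂ f₃ : A}
    (h₁ : f₁ * f₁ = s • f₁) (h₂ : f₂ * f₂ = s • f₂) (h₃ : f₃ * f₃ = s • f₃)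
    (h₁₂ : f₁ * f₂ * f₁ = f₁) (h₂₁ : f₂ * f₁ * f₂ = f₂) (h₂₃ : f₂ * f₃ * f₂ = f₂)
    (h₃₂ : f₃ * f₂ * f₃ = f₃) (h₁₃ : f₁ * f₃ = f₃ * f₁) (h : jonesWenzlElement s f₁ f₂ = 0) :
    jonesWenzlElement s f₂ f₃ = 0 := by
  obtain ⟨a, ha⟩ : ∃ a : ℂ, a * a + s * a + 1 = 0 := by
    -- As `s² = 2`, the discriminant `s² - 4 = -2` is `(s i)²`.
    refine ⟨s * (Complex.I - 1) / 2, ?_⟩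
    linear_combination (Complex.I * Complex.I - 1) / 4 * hs + Complex.I_mul_I / 2
  have b₁₂ := braid_mul ha h₁ h₂ h₁₂ h₂₁
  have b₂₃ := braid_mul ha h₂ h₃ h₂₃ h₃₂
  have hw := ((isUnit_one_add_smul ha h₁).mul (isUnit_one_add_smul ha h₂)).mul
    (isUnit_one_add_smul ha h₃)
  have c₁ : f₁ * (1 + a • f₃) = (1 + a • f₃) * f₁ := by
    rw [mul_add, add_mul, mul_smul_comm, smul_mul_assoc, h₁₃, mul_one, one_mul]
  have c₃ : f₃ * (1 + a • f₁) = (1 + a • f₁) * f₃ := by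
    rw [mul_add, add_mul, mul_smul_comm, smul_mul_assoc, h₁₃, mul_one, one_mul]
  generalize 1 + a • f₁ = g₁ at *
  generalize 1 + a • f₂ = g₂ at *
  generalize 1 + a • f₃ = g₃ at *
  -- The product `w = g₁ g₂ g₃` conjugates `f₁` to `f₂` and `f₂` to `f₃`, hence carries one
  -- Jones-Wenzl element to the other.
  have w₁ : g₁ * g₂ * g₃ * f₁ = f₂ * (g₁ * g₂ * g₃) := by
    rw [mul_assoc, ← c₁, ← mul_assoc, b₁₂, mul_assoc f₂]
  have w₂ : g₁ * g₂ * g₃ * f₂ = f₃ * (g₁ * g₂ * g₃) := by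
    rw [mul_assoc g₁, mul_assoc g₁, b₂₃, ← mul_assoc, ← c₃, mul_assoc]
  generalize g₁ * g₂ * g₃ = w at *
  have key : jonesWenzlElement s f₂ f₃ * w = w * jonesWenzlElement s f₁ f₂ := by
    simp only [jonesWenzlElement, add_mul, mul_add, sub_mul, mul_sub, one_mul, mul_one,
      smul_add, smul_mul_assoc, mul_smul_comm, w₁, w₂, mul_assoc]
    simp only [← mul_assoc, w₁, w₂]
    simp only [mul_assoc, w₁, w₂]
  rwa [h, mul_zero, hw.mul_left_eq_zero] at key

end LoopSqrtTwo

/-! ### Temperley-Lieb algebras -/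

namespace TemperleyLieb

variable {n : ℕ} {q : ℂ}

theorem gen_mul_self (i : Fin (n - 1)) : gen n q i * gen n q i = (-(q + q⁻¹)) • gen n q i := by
  simpa only [gen, map_mul, map_smul] using RingQuot.mkAlgHom_rel ℂ (Rel.sq (q := q) i)

theorem gen_mul_gen_mul_gen (i j : Fin (n - 1)) (h : (i : ℕ) + 1 = j ∨ (j : ℕ) + 1 = i) :
    gen n q i * gen n q j * gen n q i = gen n q i := by
  simpa only [gen, map_mul] using RingQuot.mkAlgHom_rel ℂ (Rel.adjacent (q := q) i j h)

theorem gen_commute (i j : Fin (n - 1)) (h : (i : ℕ) + 2 ≤ j ∨ (j : ℕ) + 2 ≤ i) :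
    Commute (gen n q i) (gen n q j) := by
  have := RingQuot.mkAlgHom_rel ℂ (Rel.distant (q := q) i j h)
  rwa [map_mul, map_mul] at this

theorem exists_algHom {A : Type*} [Ring A] [Algebra ℂ A] (g : Fin (n - 1) → A)
    (hsq : ∀ i, g i * g i = (-(q + q⁻¹)) • g i)
    (hadj : ∀ i j : Fin (n - 1), (i : ℕ) + 1 = j ∨ (j : ℕ) + 1 = i → g i * g j * g i = g i)
    (hdist : ∀ i j : Fin (n - 1), (i : ℕ) + 2 ≤ j → g i * g j = g j * g i) :
    ∃ φ : TemperleyLieb n q →ₐ[ℂ] A, ∀ i, φ (gen n q i) = g i := by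
  refine ⟨RingQuot.liftAlgHom ℂ ⟨FreeAlgebra.lift ℂ g, fun x y hxy => ?_⟩, fun i => by
    rw [gen, RingQuot.liftAlgHom_mkAlgHom_apply, FreeAlgebra.lift_ι_apply]⟩
  cases hxy with
  | sq i => simpa using hsq i
  | adjacent i j h => simpa using hadj i j h
  | distant i j h =>
    rcases h with h | h
    · simpa using hdist i j h
    · simpa using (hdist j i h).symm

theorem algHom_ext {A : Type*} [Ring A] [Algebra ℂ A] {f g : TemperleyLieb n q →ₐ[ℂ] A}
    (h : ∀ i, f (gen n q i) = g (gen n q i)) : f = g := by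
  apply RingQuot.ringQuot_ext'
  ext i
  exact h i

@[simp]
theorem incl_gen {m : ℕ} (h : m ≤ n) (i : Fin (m - 1)) :
    incl q h (gen m q i) = gen n q (Fin.castLE (Nat.sub_le_sub_right h 1) i) := by
  rw [incl, gen, RingQuot.liftAlgHom_mkAlgHom_apply, FreeAlgebra.lift_ι_apply]

theorem isJonesWenzl_jonesWenzlElement {s : ℂ} (hs : s * s = 2) (hq : -(q + q⁻¹) = s) :
    IsJonesWenzl (jonesWenzlElement s (gen (4 - 1) q 0) (gen (4 - 1) q 1)) := by
  have h0 := gen_mul_self (n := 4 - 1) (q := q) 0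
  have h1 := gen_mul_self (n := 4 - 1) (q := q) 1
  rw [hq] at h0 h1
  have h01 := gen_mul_gen_mul_gen (n := 4 - 1) (q := q) 0 1 (by decide)
  have h10 := gen_mul_gen_mul_gen (n := 4 - 1) (q := q) 1 0 (by decide)
  refine ⟨fun h => ?_, jonesWenzlElement_mul_self hs h0 h1 h01 h10, fun j => ?_, fun j => ?_⟩
  -- The character that kills all generators takes the value `1` on the element, so it is nonzero.
  · obtain ⟨ε, hε⟩ := exists_algHom (n := 4 - 1) (q := q) (A := ℂ) (fun _ => 0) (by simp) (by simp)
      (by simp)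
    have := congrArg ε h
    simp [hε, jonesWenzlElement] at this
  · match j with
    | 0 => exact mul_jonesWenzlElement hs h0 h01
    | 1 => rw [jonesWenzlElement_comm]; exact mul_jonesWenzlElement hs h1 h10
  · match j with
    | 0 => exact jonesWenzlElement_mul hs h0 h01
    | 1 => rw [jonesWenzlElement_comm]; exact jonesWenzlElement_mul hs h1 h10

end TemperleyLieb

theorem neg_isingParameter_add_inv : -(isingParameter + isingParameter⁻¹) = (Real.sqrt 2 : ℂ) := by
  have h := Complex.two_cos (Real.pi / 4)
  have hc : Complex.cos (Real.pi / 4) = ((Real.sqrt 2 / 2 : ℝ) : ℂ) := by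
    rw [← Real.cos_pi_div_four]
    push_cast
    rfl
  rw [hc] at h
  rw [isingParameter, inv_neg, ← Complex.exp_neg, neg_add, neg_neg, neg_neg,
    show (Real.pi * Complex.I / 4 : ℂ) = Real.pi / 4 * Complex.I by ring, ← neg_mul, ← h]
  push_cast
  ring

theorem sqrt_two_mul_self_complex : (Real.sqrt 2 : ℂ) * (Real.sqrt 2 : ℂ) = 2 := by
  rw [← Complex.ofReal_mul, Real.mul_self_sqrt zero_le_two, Complex.ofReal_ofNat]

/-! ### Jones algebras -/

namespace JonesAlgebra

variable {n : ℕ} {q : ℂ}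

theorem mk_surjective (ℓ n : ℕ) (q : ℂ) : Function.Surjective (mk ℓ n q) :=
  RingCon.mkₐ_surjective _

theorem mk_eq_zero_iff {ℓ : ℕ} (x : TemperleyLieb n q) :
    mk ℓ n q x = 0 ↔ x ∈ TemperleyLieb.jonesIdeal ℓ n q := by
  rw [TwoSidedIdeal.mem_iff]
  exact RingCon.eq _

theorem exists_algHom {ℓ : ℕ} {A : Type*} [Ring A] [Algebra ℂ A] (φ : TemperleyLieb n q →ₐ[ℂ] A)
    (hφ : ∀ (h : ℓ - 1 ≤ n) (E : TemperleyLieb (ℓ - 1) q), E.IsJonesWenzl →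
      φ (TemperleyLieb.incl q h E) = 0) :
    ∃ φbar : JonesAlgebra ℓ n q →ₐ[ℂ] A, ∀ x, φbar (mk ℓ n q x) = φ x := by
  have hle : TemperleyLieb.jonesIdeal ℓ n q ≤ TwoSidedIdeal.ker φ := by
    refine TwoSidedIdeal.span_le.mpr ?_
    rintro _ ⟨h, E, hE, rfl⟩
    exact (TwoSidedIdeal.mem_ker φ).mpr (hφ h E hE)
  refine ⟨RingCon.liftₐ _ φ fun x y hxy => ?_, fun x => rfl⟩
  have h := hle (((TemperleyLieb.jonesIdeal ℓ n q).rel_iff x y).mp hxy)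
  rw [TwoSidedIdeal.mem_ker, map_sub, sub_eq_zero] at h
  exact h

/-- The pair at `k = 0` vanishes by definition of the ideal; braid conjugation carries the vanishing
from each pair to the next. -/
theorem jonesWenzlElement_mk_eq_zero {s : ℂ} (hs : s * s = 2) (hq : -(q + q⁻¹) = s) (k : ℕ)
    (hk : k + 1 < n - 1) :
    jonesWenzlElement s (mk 4 n q (TemperleyLieb.gen n q ⟨k, by omega⟩))
      (mk 4 n q (TemperleyLieb.gen n q ⟨k + 1, hk⟩)) = 0 := by
  rw [← map_jonesWenzlElement]
  induction k with
  | zero =>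
    have h : 4 - 1 ≤ n := by omega
    have hmem : TemperleyLieb.incl q h (jonesWenzlElement s (TemperleyLieb.gen (4 - 1) q 0)
        (TemperleyLieb.gen (4 - 1) q 1)) ∈ TemperleyLieb.jonesIdeal 4 n q :=
      TwoSidedIdeal.subset_span
        ⟨h, _, TemperleyLieb.isJonesWenzl_jonesWenzlElement hs hq, rfl⟩
    rw [map_jonesWenzlElement, TemperleyLieb.incl_gen, TemperleyLieb.incl_gen] at hmem
    exact (mk_eq_zero_iff _).mpr hmem
  | succ k ih =>
    have ih := ih (by omega)
    rw [map_jonesWenzlElement] at ih ⊢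
    have hsq : ∀ i, mk 4 n q (TemperleyLieb.gen n q i) * mk 4 n q (TemperleyLieb.gen n q i) =
        s • mk 4 n q (TemperleyLieb.gen n q i) := fun i => by
      rw [← map_mul, TemperleyLieb.gen_mul_self, map_smul, hq]
    have hadj : ∀ i j : Fin (n - 1), (i : ℕ) + 1 = j ∨ (j : ℕ) + 1 = i →
        mk 4 n q (TemperleyLieb.gen n q i) * mk 4 n q (TemperleyLieb.gen n q j) *
          mk 4 n q (TemperleyLieb.gen n q i) = mk 4 n q (TemperleyLieb.gen n q i) :=
      fun i j h => by rw [← map_mul, ← map_mul, TemperleyLieb.gen_mul_gen_mul_gen i j h]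
    refine jonesWenzlElement_eq_zero_of_adjacent hs (hsq _) (hsq _) (hsq _) (hadj _ _ ?_)
      (hadj _ _ ?_) (hadj _ _ ?_) (hadj _ _ ?_) ?_ ih
    · simp
    · simp
    · simp
    · simp
    · exact (TemperleyLieb.gen_commute _ _ (by simp)).map (mk 4 n q)

end JonesAlgebra

/-! ### The Ising algebra and the even Clifford algebra -/

section IsingToClifford

variable {n : ℕ} {U : Type*} [AddCommGroup U] [Module ℂ U] {B : LinearMap.BilinForm ℂ U}
  {u : Module.Basis (Fin n) ℂ U}

theorem IsOrthonormalBasis.I_smul_evenPair_mul_self (hu : IsOrthonormalBasis B u) {i j : Fin n}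
    (hij : i ≠ j) :
    (Complex.I • evenPair B u i j) * (Complex.I • evenPair B u i j) = 1 := by
  rw [smul_mul_smul_comm, Complex.I_mul_I]
  nth_rw 2 [hu.evenPair_swap hij]
  rw [mul_neg, hu.evenPair_mul_evenPair, hu.evenPair_self, neg_smul, one_smul, neg_neg]

/-- Contracting the shared vector `u j` leaves `u i * u k` in one order and `u k * u i` in the
other. -/
theorem IsOrthonormalBasis.I_smul_evenPair_anticomm (hu : IsOrthonormalBasis B u) {i j k : Fin n}
    (hij : i ≠ j) (hjk : j ≠ k) (hik : i ≠ k) :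
    (Complex.I • evenPair B u i j) * (Complex.I • evenPair B u j k) =
      -((Complex.I • evenPair B u j k) * (Complex.I • evenPair B u i j)) := by
  rw [smul_mul_smul_comm, smul_mul_smul_comm, hu.evenPair_mul_evenPair, ← smul_neg,
    hu.evenPair_swap hik, hu.evenPair_swap hij, hu.evenPair_swap hjk, neg_mul_neg,
    hu.evenPair_mul_evenPair]

theorem coe_inv_smul_one_add_evenPair (B : LinearMap.BilinForm ℂ U)
    (u : Module.Basis (Fin n) ℂ U) (i j : Fin n) :
    (((Real.sqrt 2 : ℂ)⁻¹ • (1 + Complex.I • evenPair B u i j) : evenCliffordOf B) :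
        cliffordOf B) =
      (1 / (Real.sqrt 2 : ℂ)) •
        (1 + (2 * Complex.I) • (cliffordGamma B u i * cliffordGamma B u j)) := by
  have hs := sqrt_two_mul_self_complex
  have hs0 : (Real.sqrt 2 : ℂ) ≠ 0 := fun h => by simp [h] at hs
  have h : cliffordGamma B u i * cliffordGamma B u j =
      (2⁻¹ : ℂ) • (evenPair B u i j : cliffordOf B) := by
    rw [cliffordGamma, cliffordGamma, map_smul, map_smul, smul_mul_smul_comm, div_mul_div_comm, hs,
      one_mul, one_div]
    rfl
  rw [h, smul_smul, one_div, mul_right_comm, mul_inv_cancel₀ two_ne_zero, one_mul]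
  rfl

/-- The homomorphism from the Temperley-Lieb algebra to the even Clifford algebra. -/
theorem IsOrthonormalBasis.exists_algHom_temperleyLieb (hu : IsOrthonormalBasis B u) :
    ∃ φ : TemperleyLieb n isingParameter →ₐ[ℂ] evenCliffordOf B, ∀ j : Fin (n - 1),
      φ (TemperleyLieb.gen n isingParameter j) = (Real.sqrt 2 : ℂ)⁻¹ •
        (1 + Complex.I • evenPair B u ⟨j, by omega⟩ ⟨j + 1, by omega⟩) := by
  have hs := sqrt_two_mul_self_complex
  have hsq : ∀ j : Fin (n - 1), (Complex.I • evenPair B u ⟨j, by omega⟩ ⟨j + 1, by omega⟩) *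
      (Complex.I • evenPair B u ⟨j, by omega⟩ ⟨j + 1, by omega⟩) = 1 :=
    fun j => hu.I_smul_evenPair_mul_self (by simp)
  refine TemperleyLieb.exists_algHom _ (fun j => ?_) (fun i j hij => ?_) fun i j hij => ?_
  · rw [neg_isingParameter_add_inv]
    exact inv_smul_one_add_mul_self hs (hsq j)
  · refine inv_smul_one_add_mul_mul hs (hsq i) ?_
    obtain ⟨i, hi⟩ := i
    obtain ⟨j, hj⟩ := j
    rcases hij with rfl | rfl
    · exact hu.I_smul_evenPair_anticomm (by simp) (by simp) (by simp [add_assoc])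
    · exact (neg_eq_iff_eq_neg.mpr
        (hu.I_smul_evenPair_anticomm (by simp) (by simp) (by simp [add_assoc]))).symm
  · have h : Commute (evenPair B u ⟨i, by omega⟩ ⟨i + 1, by omega⟩)
        (evenPair B u ⟨j, by omega⟩ ⟨j + 1, by omega⟩) := by
      apply hu.evenPair_commute <;> (simp only [ne_eq, Fin.mk.injEq]; omega)
    have h' := (h.smul_right Complex.I).smul_left Complex.I
    have h'' := (Commute.one_left _).add_left ((Commute.one_right _).add_right h')
    exact (h''.smul_right _).smul_left _

theorem sqrt_two_smul_inv_smul_sub_one {A : Type*} [Ring A] [Algebra ℂ A] (e : A) :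
    (Real.sqrt 2 : ℂ) • ((Real.sqrt 2 : ℂ)⁻¹ • (1 + e)) - 1 = e := by
  have hs0 : (Real.sqrt 2 : ℂ) ≠ 0 := fun h => by simpa [h] using sqrt_two_mul_self_complex
  rw [smul_smul, mul_inv_cancel₀ hs0, one_smul, add_sub_cancel_left]

/-- Uniqueness replaces `E` by the explicit element; twice its image is an anticommutator of two
consecutive `i u_j u_{j+1}`, hence zero. -/
theorem IsOrthonormalBasis.map_incl_eq_zero (hu : IsOrthonormalBasis B u)
    {φ : TemperleyLieb n isingParameter →ₐ[ℂ] evenCliffordOf B}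
    (hφ : ∀ j : Fin (n - 1),
      φ (TemperleyLieb.gen n isingParameter j) = (Real.sqrt 2 : ℂ)⁻¹ •
        (1 + Complex.I • evenPair B u ⟨j, by omega⟩ ⟨j + 1, by omega⟩))
    (h : 4 - 1 ≤ n) (E : TemperleyLieb (4 - 1) isingParameter) (hE : E.IsJonesWenzl) :
    φ (TemperleyLieb.incl isingParameter h E) = 0 := by
  rw [hE.eq (TemperleyLieb.isJonesWenzl_jonesWenzlElement sqrt_two_mul_self_complex
    neg_isingParameter_add_inv), map_jonesWenzlElement, map_jonesWenzlElement,
    TemperleyLieb.incl_gen, TemperleyLieb.incl_gen, hφ, hφ]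
  refine (smul_eq_zero_iff_right (two_ne_zero' ℂ)).mp ?_
  rw [← anticommutator_eq_jonesWenzlElement sqrt_two_mul_self_complex,
    sqrt_two_smul_inv_smul_sub_one, sqrt_two_smul_inv_smul_sub_one]
  refine add_eq_zero_iff_eq_neg.mpr ?_
  exact hu.I_smul_evenPair_anticomm (by simp) (by simp) (by simp)

/-- In the Ising algebra, the square root of `-1` that corresponds to the product of two
consecutive vectors of an orthonormal basis. -/
noncomputable def isingRoot (n k : ℕ) : JonesAlgebra 4 n isingParameter :=
  -- The default `0` is harmless: chain products of length at most `n - 1` only use indices `k < n -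
  -- 1`.
  if h : k < n - 1 then (-Complex.I) • ((Real.sqrt 2 : ℂ) •
    JonesAlgebra.mk 4 n isingParameter (TemperleyLieb.gen n isingParameter ⟨k, h⟩) - 1) else 0

theorem isingRoot_mul_self {k : ℕ} (hk : k < n - 1) : isingRoot n k * isingRoot n k = -1 := by
  rw [isingRoot, dif_pos hk, smul_mul_smul_comm, smul_sub_one_mul_self sqrt_two_mul_self_complex,
    neg_mul_neg, Complex.I_mul_I, neg_smul, one_smul]
  rw [← map_mul, TemperleyLieb.gen_mul_self, map_smul, neg_isingParameter_add_inv]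

theorem isingRoot_commute (i j : ℕ) (hij : i + 2 ≤ j) (hj : j < n - 1) :
    Commute (isingRoot n i) (isingRoot n j) := by
  rw [isingRoot, isingRoot, dif_pos hj, dif_pos (by omega)]
  have h := (TemperleyLieb.gen_commute (q := isingParameter) (⟨i, by omega⟩ : Fin (n - 1)) ⟨j, hj⟩
    (Or.inl hij)).map (JonesAlgebra.mk 4 n isingParameter)
  have h' := ((h.smul_right (Real.sqrt 2 : ℂ)).smul_left (Real.sqrt 2 : ℂ))
  have h'' := (h'.sub_left (Commute.one_left _)).sub_right (Commute.one_right _)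
  exact (h''.smul_right _).smul_left _

theorem isingRoot_anticomm (k : ℕ) (hk : k + 1 < n - 1) :
    isingRoot n k * isingRoot n (k + 1) = -(isingRoot n (k + 1) * isingRoot n k) := by
  rw [isingRoot, isingRoot, dif_pos hk, dif_pos (by omega), smul_mul_smul_comm,
    smul_mul_smul_comm, ← smul_neg]
  congr 1
  refine eq_neg_of_add_eq_zero_left ?_
  rw [anticommutator_eq_jonesWenzlElement sqrt_two_mul_self_complex,
    JonesAlgebra.jonesWenzlElement_mk_eq_zero sqrt_two_mul_self_complex neg_isingParameter_add_inv
      k hk, smul_zero]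

theorem map_isingRoot
    (φbar : JonesAlgebra 4 n isingParameter →ₐ[ℂ] evenCliffordOf B)
    (hφ : ∀ j : Fin (n - 1),
      φbar (JonesAlgebra.mk 4 n isingParameter (TemperleyLieb.gen n isingParameter j)) =
        (Real.sqrt 2 : ℂ)⁻¹ • (1 + Complex.I • evenPair B u ⟨j, by omega⟩ ⟨j + 1, by omega⟩))
    {k : ℕ} (hk : k + 1 < n) :
    φbar (isingRoot n k) = evenPair B u ⟨k, by omega⟩ ⟨k + 1, hk⟩ := by
  rw [isingRoot, dif_pos (by omega), map_smul, map_sub, map_smul, hφ, map_one,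
    sqrt_two_smul_inv_smul_sub_one, smul_smul, neg_mul, Complex.I_mul_I, neg_neg, one_smul]

theorem inv_sqrt_two_smul_isingRoot {k : ℕ} (hk : k < n - 1) :
    (Real.sqrt 2 : ℂ)⁻¹ • (1 + Complex.I • isingRoot n k) =
      JonesAlgebra.mk 4 n isingParameter (TemperleyLieb.gen n isingParameter ⟨k, hk⟩) := by
  have hs0 : (Real.sqrt 2 : ℂ) ≠ 0 := fun h => by simpa [h] using sqrt_two_mul_self_complex
  rw [isingRoot, dif_pos hk, smul_smul, mul_neg, Complex.I_mul_I, neg_neg, one_smul,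
    add_sub_cancel, smul_smul, inv_mul_cancel₀ hs0, one_smul]

/-- The homomorphism from the even Clifford algebra to the Ising algebra. -/
theorem IsOrthonormalBasis.exists_algHom_jonesAlgebra (hu : IsOrthonormalBasis B u) :
    ∃ ψ : evenCliffordOf B →ₐ[ℂ] JonesAlgebra 4 n isingParameter, ∀ i j : Fin n,
      ψ (evenPair B u i j) = chainProdInv (isingRoot n) i * chainProd (isingRoot n) j := by
  have hsq : ∀ k < n - 1, isingRoot n k * isingRoot n k = -1 := fun k hk => isingRoot_mul_self hk
  have hne : ∀ i j : Fin n, i ≠ j → (i : ℕ) ≠ j := fun i j h h' => h (Fin.ext h')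
  -- The factorisation `u_i u_j = (u_i u_0)(u_0 u_j)` dictates the two families.
  exact ⟨_, hu.evenLift_evenPair (fun i => chainProd (isingRoot n) i)
    (fun i => chainProdInv (isingRoot n) i)
    (fun i => chainProdInv_mul_chainProd hsq (by omega))
    (fun i j hij => chainProdInv_mul_chainProd_antisymm hsq isingRoot_commute isingRoot_anticomm
      (hne i j hij) (by omega) (by omega))
    (fun i => chainProd_mul_chainProdInv hsq (by omega))
    (fun i j hij => chainProd_mul_chainProdInv_antisymm hsq isingRoot_commute isingRoot_anticomm
      (hne i j hij) (by omega) (by omega))⟩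

/-- The product `(u_0 u_1)(u_1 u_2) ⋯` telescopes. -/
theorem IsOrthonormalBasis.map_chainProd (hu : IsOrthonormalBasis B u)
    (φbar : JonesAlgebra 4 n isingParameter →ₐ[ℂ] evenCliffordOf B)
    (hφ : ∀ (k : ℕ) (hk : k + 1 < n),
      φbar (isingRoot n k) = evenPair B u ⟨k, by omega⟩ ⟨k + 1, hk⟩) (k : ℕ) (hk : k < n) :
    φbar (chainProd (isingRoot n) k) = evenPair B u ⟨0, by omega⟩ ⟨k, hk⟩ := by
  induction k with
  | zero => rw [chainProd, map_one, hu.evenPair_self]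
  | succ k ih => rw [chainProd, map_mul, ih (by omega), hφ k hk, hu.evenPair_mul_evenPair]

theorem IsOrthonormalBasis.map_chainProdInv (hu : IsOrthonormalBasis B u)
    (φbar : JonesAlgebra 4 n isingParameter →ₐ[ℂ] evenCliffordOf B)
    (hφ : ∀ (k : ℕ) (hk : k + 1 < n),
      φbar (isingRoot n k) = evenPair B u ⟨k, by omega⟩ ⟨k + 1, hk⟩) (k : ℕ) (hk : k < n) :
    φbar (chainProdInv (isingRoot n) k) = evenPair B u ⟨k, hk⟩ ⟨0, by omega⟩ := by
  induction k with
  | zero => rw [chainProdInv, map_one, hu.evenPair_self]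
  | succ k ih =>
    rw [chainProdInv, map_neg, map_mul, ih (by omega), hφ k hk, hu.evenPair_swap (by simp),
      neg_mul, neg_neg, hu.evenPair_mul_evenPair]

end IsingToClifford

theorem mainTheorem9 (n : ℕ) (hn : 3 ≤ n) {U : Type*} [AddCommGroup U] [Module ℂ U]
    [FiniteDimensional ℂ U] (hU : Module.finrank ℂ U = n) (B : LinearMap.BilinForm ℂ U)
    (hsymm : B.IsSymm) (hnd : B.Nondegenerate) :
    (∃ u : Module.Basis (Fin n) ℂ U, IsOrthonormalBasis B u) ∧
    ∀ u : Module.Basis (Fin n) ℂ U, IsOrthonormalBasis B u →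
      ∃ φ : TemperleyLieb n isingParameter →ₐ[ℂ] evenCliffordOf B,
        (∀ j : Fin (n - 1),
          (φ (TemperleyLieb.gen n isingParameter j) : cliffordOf B) =
            (1 / (Real.sqrt 2 : ℂ)) •
              (1 + (2 * Complex.I) •
                (cliffordGamma B u ⟨j, by omega⟩ * cliffordGamma B u ⟨j + 1, by omega⟩))) ∧
        Function.Surjective φ ∧
        ∃ φbar : JonesAlgebra 4 n isingParameter ≃ₐ[ℂ] evenCliffordOf B,
          ∀ x : TemperleyLieb n isingParameter,
            φbar (JonesAlgebra.mk 4 n isingParameter x) = φ x := by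
  refine ⟨exists_isOrthonormalBasis hU B hsymm hnd, fun u hu => ?_⟩
  obtain ⟨φ, hφ⟩ := hu.exists_algHom_temperleyLieb
  obtain ⟨φbar, hφbar⟩ := JonesAlgebra.exists_algHom φ (hu.map_incl_eq_zero hφ)
  obtain ⟨ψ, hψ⟩ := hu.exists_algHom_jonesAlgebra
  have hroot : ∀ (k : ℕ) (hk : k + 1 < n),
      φbar (isingRoot n k) = evenPair B u ⟨k, by omega⟩ ⟨k + 1, hk⟩ := fun k hk =>
    map_isingRoot φbar (fun j => by rw [hφbar, hφ]) hk
  have hright : φbar.comp ψ = AlgHom.id ℂ _ := by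
    refine evenClifford_algHom_ext (u := u) fun i j => ?_
    rw [AlgHom.comp_apply, hψ, map_mul, hu.map_chainProdInv φbar hroot i i.2,
      hu.map_chainProd φbar hroot j j.2, hu.evenPair_mul_evenPair, AlgHom.id_apply]
  have hleft : (ψ.comp φbar).comp (JonesAlgebra.mk 4 n isingParameter) =
      JonesAlgebra.mk 4 n isingParameter := by
    refine TemperleyLieb.algHom_ext fun j => ?_
    -- The image of `u_j u_{j+1}` is `c_j⁻¹ c_{j+1} = c_j⁻¹ c_j b_j = b_j`, from which the generator
    -- is recovered.
    have hinv := chainProdInv_mul_chainProd (b := isingRoot n) (m := n - 1)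
      (fun k hk => isingRoot_mul_self hk) j.2.le
    rw [AlgHom.comp_apply, AlgHom.comp_apply, hφbar, hφ, map_smul, map_add, map_one, map_smul, hψ,
      chainProd, ← mul_assoc, hinv, one_mul, inv_sqrt_two_smul_isingRoot j.2]
  have hleft' : ψ.comp φbar = AlgHom.id ℂ _ := by
    refine AlgHom.ext fun x => ?_
    obtain ⟨x, rfl⟩ := JonesAlgebra.mk_surjective 4 n isingParameter x
    exact DFunLike.congr_fun hleft x
  refine ⟨φ, fun j => by rw [hφ, coe_inv_smul_one_add_evenPair], fun y => ?_,
    AlgEquiv.ofAlgHom φbar ψ hright hleft', hφbar⟩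
  -- A preimage of `y` under `φ` is any lift of `ψ y` to the Temperley-Lieb algebra.
  obtain ⟨x, hx⟩ := JonesAlgebra.mk_surjective 4 n isingParameter (ψ y)
  exact ⟨x, by rw [← hφbar, hx]; exact DFunLike.congr_fun hright y⟩
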